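/- For $k\ge 0$, a $k$-marked group is a pair $(G,S)$ where $S$ is an ordered $k$-tuple of generators (a $k$-marking) of the group $G$; isomorphisms of marked groups must carry the one marking to the other. Let $\mathcal G_k$ be the set of isomorphism classes of $k$-marked groups, with the metric in which two classes are at distance at most $e^{-R}$ ($R\in\mathbb N$) if and only if they satisfy the same relations (reduced words in the generators and their inverses that represent the trivial element) of length at most $R$; distance $0$ means that they satisfy the same relations. Let $F$ be Thompson's group, that is, the group of self-homeomorphisms of $[0,\infty)$ generated by the maps $x_i$, $i=0,1,2,\dots$, where $$x_i(t)=\begin{cases} t, & t\le i,\\ i+2(t-i), & i\le t\le i+1,\\ t+1, & t\ge i+1.\end{cases}$$ **Theorem.** The free group of rank $2$, marked by its standard basis, is a limit of $2$-markings of $F$: there is a sequence of $2$-marked groups, each isomorphic as an unmarked group to $F$, whose classes converge in $\mathcal G_2$ to the class of the free group of rank $2$ with its standard basis. Equivalently, for every $n\in\mathbb N$ there is a pair $(X_0,X_1)$ that generates $F$ and such that no nontrivial reduced word of length at most $n$ in $X_0^{\pm1},X_1^{\pm1}$ represents the trivial element of $F$. -/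

import Mathlib

open Filter Topology
open scoped NNReal

/-! ### Thompson's group `F` acting on the non-negative reals -/

namespace ThompsonF

/-- The piecewise linear map `x_i`: the identity on `[0, i]`, slope `2` on `[i, i + 1]`,
and translation by `1` on `[i + 1, ∞)`. -/
noncomputable def xFun (i : ℕ) (t : ℝ≥0) : ℝ≥0 :=
  if t ≤ i then t else if t ≤ i + 1 then i + 2 * (t - i) else t + 1

theorem coe_xFun (i : ℕ) (t : ℝ≥0) :
    ((xFun i t : ℝ≥0) : ℝ) =
      if (t : ℝ) ≤ i then (t : ℝ) else if (t : ℝ) ≤ i + 1 then i + 2 * ((t : ℝ) - i)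
        else (t : ℝ) + 1 := by
  have h1 : (t ≤ (i : ℝ≥0)) ↔ ((t : ℝ) ≤ i) := by
    rw [← NNReal.coe_le_coe]; simp
  have h2 : (t ≤ (i : ℝ≥0) + 1) ↔ ((t : ℝ) ≤ i + 1) := by
    rw [← NNReal.coe_le_coe]; simp
  unfold xFun
  by_cases h : (t : ℝ) ≤ i
  · rw [if_pos (h1.2 h), if_pos h]
  · rw [if_neg (fun h' => h (h1.1 h')), if_neg h]
    by_cases h' : (t : ℝ) ≤ i + 1
    · rw [if_pos (h2.2 h'), if_pos h']
      have h3 : (i : ℝ≥0) ≤ t := by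
        rw [← NNReal.coe_le_coe]; simpa using (not_le.1 h).le
      push_cast [NNReal.coe_sub h3]
      ring
    · rw [if_neg (fun h'' => h' (h2.1 h'')), if_neg h']
      push_cast
      ring

theorem xFun_strictMono (i : ℕ) : StrictMono (xFun i) := by
  intro s t hst
  rw [← NNReal.coe_lt_coe] at hst ⊢
  rw [coe_xFun, coe_xFun]
  split_ifs <;> linarith

theorem xFun_surjective (i : ℕ) : Function.Surjective (xFun i) := by
  intro t
  have ht : (0 : ℝ) ≤ t := t.2
  have hi : (0 : ℝ) ≤ i := Nat.cast_nonneg i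
  by_cases h1 : (t : ℝ) ≤ i
  · refine ⟨t, ?_⟩
    rw [← NNReal.coe_inj, coe_xFun, if_pos h1]
  · by_cases h2 : (t : ℝ) ≤ i + 2
    · refine ⟨(t + i) / 2, ?_⟩
      rw [← NNReal.coe_inj, coe_xFun]
      push_cast
      split_ifs <;> linarith
    · have h3 : (1 : ℝ≥0) ≤ t := by
        rw [← NNReal.coe_le_coe, NNReal.coe_one]; linarith
      refine ⟨t - 1, ?_⟩
      rw [← NNReal.coe_inj, coe_xFun, NNReal.coe_sub h3, NNReal.coe_one]
      split_ifs <;> linarith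

/-- The self-homeomorphism `x_i` of `[0, ∞)`. -/
noncomputable def x (i : ℕ) : ℝ≥0 ≃ₜ ℝ≥0 :=
  ((xFun_strictMono i).orderIsoOfSurjective (xFun i) (xFun_surjective i)).toHomeomorph

theorem x_apply (i : ℕ) (t : ℝ≥0) : x i t = xFun i t := rfl

/-- Thompson's group `F`: the group of self-homeomorphisms of `[0, ∞)` generated by
`x_0, x_1, x_2, …`.  The product of homeomorphisms is composition, `(f * g) t = f (g t)`;
composing in the opposite order gives the same set of homeomorphisms and an isomorphic group. -/
noncomputable def F : Subgroup (ℝ≥0 ≃ₜ ℝ≥0) := Subgroup.closure (Set.range x)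

end ThompsonF

/-! ### The space of marked groups -/

/-- A `k`-marked group: a group with an ordered `k`-tuple of generators.  (A group with a finite
generating set is countable, so each of them has a copy in `Type`.) -/
structure MarkedGroup (k : ℕ) where
  /-- the underlying set -/
  carrier : Type
  /-- the group structure -/
  [group : Group carrier]
  /-- the marking -/
  marking : Fin k → carrier
  /-- the marking generates -/
  generates : Subgroup.closure (Set.range marking) = ⊤

namespace MarkedGroup

attribute [instance] MarkedGroup.group

variable {k : ℕ}

/-- Marked groups are isomorphic when there is a group isomorphism that carries the one marking
to the other. -/
instance setoid (k : ℕ) : Setoid (MarkedGroup k) where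
  r A B := ∃ e : A.carrier ≃* B.carrier, ∀ i, e (A.marking i) = B.marking i
  iseqv :=
    { refl := fun A => ⟨MulEquiv.refl _, fun _ => rfl⟩
      symm := by
        rintro A B ⟨e, he⟩
        exact ⟨e.symm, fun i => by rw [← he i, e.symm_apply_apply]⟩
      trans := by
        rintro A B C ⟨e, he⟩ ⟨f, hf⟩
        exact ⟨e.trans f, fun i => by rw [MulEquiv.trans_apply, he i, hf i]⟩ }

/-- The evaluation of words at the marking. -/
def eval (A : MarkedGroup k) : FreeGroup (Fin k) →* A.carrier := FreeGroup.lift A.marking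

theorem eval_surjective (A : MarkedGroup k) : Function.Surjective A.eval := by
  rw [← MonoidHom.range_eq_top, eval, FreeGroup.range_lift_eq_closure, A.generates]

/-- The relations satisfied by a marked group: the reduced words that are trivial in it. -/
def relations (A : MarkedGroup k) : Subgroup (FreeGroup (Fin k)) := A.eval.ker

theorem relations_eq_iff (A B : MarkedGroup k) : A.relations = B.relations ↔ A ≈ B := by
  constructor
  · intro h
    have h : A.eval.ker = B.eval.ker := h
    have hA := A.eval_surjective
    have hB := B.eval_surjective
    let e : A.carrier ≃* B.carrier :=
      (QuotientGroup.quotientKerEquivOfSurjective A.eval hA).symm.trans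
        ((QuotientGroup.quotientMulEquivOfEq h).trans
          (QuotientGroup.quotientKerEquivOfSurjective B.eval hB))
    have key : ∀ w, e (A.eval w) = B.eval w := by
      intro w
      have h1 : (QuotientGroup.quotientKerEquivOfSurjective A.eval hA).symm (A.eval w)
          = (w : FreeGroup (Fin k) ⧸ A.eval.ker) := by
        rw [MulEquiv.symm_apply_eq]; rfl
      simp only [e, MulEquiv.trans_apply, h1]
      rfl
    refine ⟨e, fun i => ?_⟩
    have := key (FreeGroup.of i)
    simpa [eval] using this
  · rintro ⟨e, he⟩
    have h : e.toMonoidHom.comp A.eval = B.eval := by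
      ext i
      simp [eval, he]
    ext w
    rw [relations, relations, MonoidHom.mem_ker, MonoidHom.mem_ker, ← h]
    simp

end MarkedGroup

/-- The set `𝒢_k` of isomorphism classes of `k`-marked groups. -/
def MarkedGroupSpace (k : ℕ) : Type 1 := Quotient (MarkedGroup.setoid k)

namespace MarkedGroupSpace

variable {k : ℕ}

/-- The isomorphism class of a marked group. -/
def mk (A : MarkedGroup k) : MarkedGroupSpace k := Quotient.mk _ A

/-- The relations satisfied by an isomorphism class of marked groups. -/
def relations : MarkedGroupSpace k → Subgroup (FreeGroup (Fin k)) :=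
  Quotient.lift MarkedGroup.relations fun A B h => (MarkedGroup.relations_eq_iff A B).2 h

theorem relations_injective :
    Function.Injective (relations : MarkedGroupSpace k → Subgroup (FreeGroup (Fin k))) := by
  intro a b
  induction a using Quotient.inductionOn
  induction b using Quotient.inductionOn
  intro h
  exact Quotient.sound ((MarkedGroup.relations_eq_iff _ _).1 h)

/-- The two classes satisfy the same relations of length at most `R`.  The length `w.norm` of a
word is that of its reduced form. -/
def Agree (a b : MarkedGroupSpace k) (R : ℕ) : Prop :=
  ∀ w : FreeGroup (Fin k), w.norm ≤ R → (w ∈ a.relations ↔ w ∈ b.relations)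

/-- The distance `e ^ (-R)`, for the largest `R` such that the same relations of length at most `R`
are satisfied; it is `0` if there is no largest such `R`. -/
noncomputable instance : Dist (MarkedGroupSpace k) where
  dist a b := sInf ((fun R : ℕ => Real.exp (-(R : ℝ))) '' {R : ℕ | Agree a b R})

theorem agree_zero (a b : MarkedGroupSpace k) : Agree a b 0 := by
  intro w hw
  rw [Nat.le_zero, FreeGroup.norm_eq_zero] at hw
  subst hw
  simp [one_mem]

theorem bddBelow_exp (s : Set ℕ) : BddBelow ((fun R : ℕ => Real.exp (-(R : ℝ))) '' s) :=
  ⟨0, by rintro _ ⟨R, -, rfl⟩; exact (Real.exp_pos _).le⟩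

/-- The distance is at most `e ^ (-R)` exactly if the two satisfy the same relations of length at
most `R`. -/
theorem dist_le_exp_iff (a b : MarkedGroupSpace k) (R : ℕ) :
    dist a b ≤ Real.exp (-(R : ℝ)) ↔ Agree a b R := by
  constructor
  · intro h w hw
    by_contra hne
    have hlt : Real.exp (-(R : ℝ)) < Real.exp (-(R : ℝ) + 1) := Real.exp_lt_exp.2 (by linarith)
    have hle : Real.exp (-(R : ℝ) + 1) ≤ dist a b := by
      refine le_csInf ⟨_, 0, agree_zero a b, rfl⟩ ?_
      rintro _ ⟨Q, hQ, rfl⟩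
      have hQR : Q < R := by
        by_contra hQR
        exact hne (hQ w (hw.trans (not_lt.1 hQR)))
      have : (Q : ℝ) + 1 ≤ R := by exact_mod_cast hQR
      exact Real.exp_le_exp.2 (by linarith)
    linarith
  · intro h
    exact csInf_le (bddBelow_exp _) ⟨R, h, rfl⟩

theorem dist_nonneg' (a b : MarkedGroupSpace k) : 0 ≤ dist a b :=
  Real.sInf_nonneg (by rintro _ ⟨R, -, rfl⟩; exact (Real.exp_pos _).le)

theorem exists_exp_lt {ε : ℝ} (hε : 0 < ε) : ∃ R : ℕ, Real.exp (-(R : ℝ)) < ε := by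
  have h : Tendsto (fun R : ℕ => Real.exp (-(R : ℝ))) atTop (𝓝 0) :=
    Real.tendsto_exp_neg_atTop_nhds_zero.comp tendsto_natCast_atTop_atTop
  exact (h.eventually (gt_mem_nhds hε)).exists

theorem dist_triangle_max' (a b c : MarkedGroupSpace k) :
    dist a c ≤ max (dist a b) (dist b c) := by
  by_contra! h
  obtain ⟨h1, h2⟩ := max_lt_iff.1 h
  obtain ⟨_, ⟨R, hR, rfl⟩, hRlt⟩ :=
    exists_lt_of_csInf_lt (Set.Nonempty.image _ ⟨0, agree_zero a b⟩) h1
  obtain ⟨_, ⟨Q, hQ, rfl⟩, hQlt⟩ :=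
    exists_lt_of_csInf_lt (Set.Nonempty.image _ ⟨0, agree_zero b c⟩) h2
  have hac : Agree a c (min R Q) := fun w hw =>
    (hR w (hw.trans (min_le_left _ _))).trans (hQ w (hw.trans (min_le_right _ _)))
  have hle := (dist_le_exp_iff a c _).2 hac
  rcases min_choice R Q with hm | hm <;> rw [hm] at hle <;> simp only at hRlt hQlt <;> linarith

noncomputable instance : MetricSpace (MarkedGroupSpace k) where
  dist_self a := by
    refine le_antisymm (le_of_forall_pos_le_add fun ε hε => ?_) (dist_nonneg' a a)
    obtain ⟨R, hR⟩ := exists_exp_lt hε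
    have := (dist_le_exp_iff a a R).2 fun _ _ => Iff.rfl
    linarith
  dist_comm a b := by
    have h : {R : ℕ | Agree a b R} = {R : ℕ | Agree b a R} := by
      ext R
      exact ⟨fun h w hw => (h w hw).symm, fun h w hw => (h w hw).symm⟩
    change sInf _ = sInf _
    rw [h]
  dist_triangle a b c :=
    (dist_triangle_max' a b c).trans
      (max_le_add_of_nonneg (dist_nonneg' a b) (dist_nonneg' b c))
  eq_of_dist_eq_zero := by
    intro a b h
    apply relations_injective
    ext w
    have hle : dist a b ≤ Real.exp (-(w.norm : ℝ)) := by rw [h]; exact (Real.exp_pos _).le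
    exact (dist_le_exp_iff a b _).1 hle w le_rfl

/-- The point `a` of `𝒢_k` is a limit of `k`-markings of the group `G`: the limit of a sequence of
marked groups each of which is isomorphic, as an unmarked group, to `G`. -/
def IsLimitOfMarkings (G : Type) [Group G] (a : MarkedGroupSpace k) : Prop :=
  ∃ u : ℕ → MarkedGroup k, (∀ n, Nonempty ((u n).carrier ≃* G)) ∧
    Tendsto (fun n => mk (u n)) atTop (𝓝 a)

end MarkedGroupSpace

/-- The free group of rank `k`, marked by its standard basis. -/
def MarkedGroup.free (k : ℕ) : MarkedGroup k where
  carrier := FreeGroup (Fin k)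
  marking := FreeGroup.of
  generates := FreeGroup.closure_range_of (Fin k)

/-! The generating pair is `x 0` and `g = x 1 * (x 3)⁻¹ * c * x (M + 1)`, with `c ∈ E` supported in
`[5, M]`. The outer factors make the pair generate `F` whatever `c` is, so `c` can be spent on
keeping all short words nontrivial.

Generation (`F_le_closure`): conjugation by `x 0` raises the index of each `x i`, `i ≥ 1`. Two
elements built from `g` and its conjugates have a commutator in which every part that involves `c`
drops out because of disjoint supports; what remains is `x (N + 2) * (x (N + 1))⁻¹`, where `N = M +
1`. Its conjugates by powers of `x 0` yield all of `E`, which contains `x 1 * (x 3)⁻¹ * c`; hence `x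
N`, and then every `x i`, is obtained.

Absence of short relations: on `[1, ∞)` the map `x 0` is translation by `1`, and on `[5, M]` the map
`g` is `c`, which may act independently on the unit intervals. A nontrivial word in `x 0` and `g`
then has either a nonzero net translation or a nontrivial word in these independent actions
(`wordAction_ne`, `lift_apply_window`). The latter can be made to move a point, because the elements
of `E` supported in `[1, 2]` satisfy no law (`exists_lift_ne`). The finitely many words of bounded
length are treated in disjoint blocks of `[5, M]` (`exists_forall_lift_ne_one`). -/

namespace ThompsonF

/-! ### Supports and commutation -/

/-- The group of self-homeomorphisms of `[0, ∞)`. -/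
abbrev Homeo := ℝ≥0 ≃ₜ ℝ≥0

theorem inv_apply_eq {f : Homeo} {s t : ℝ≥0} : f⁻¹ s = t ↔ s = f t := by
  constructor
  · rintro rfl; simp
  · rintro rfl; simp

theorem apply_inv_self' (f : Homeo) (t : ℝ≥0) : f (f⁻¹ t) = t := by simp

/-- The increasing homeomorphisms. -/
def increasing : Subgroup Homeo where
  carrier := {f | StrictMono f}
  one_mem' := strictMono_id
  mul_mem' hf hg := hf.comp hg
  inv_mem' {f} hf s t hst := by
    have hf : StrictMono f := hf
    rw [← hf.lt_iff_lt]; simpa using hst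

theorem apply_le_apply {f : Homeo} (hf : f ∈ increasing) {s t : ℝ≥0} (h : s ≤ t) : f s ≤ f t :=
  StrictMono.monotone hf h

theorem mem_F (i : ℕ) : x i ∈ F := Subgroup.subset_closure ⟨i, rfl⟩

theorem F_le_increasing : F ≤ increasing := by
  rw [F, Subgroup.closure_le]
  rintro _ ⟨i, rfl⟩
  exact xFun_strictMono i

/-- The homeomorphisms that are the identity on `[0, a]`. -/
def fixLE (a : ℝ≥0) : Subgroup Homeo where
  carrier := {f | ∀ t, t ≤ a → f t = t}
  one_mem' _ _ := rfl
  mul_mem' {f g} hf hg t ht := by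
    rw [Homeomorph.mul_apply, hg t ht, hf t ht]
  inv_mem' {f} hf t ht := by rw [inv_apply_eq, hf t ht]

/-- The homeomorphisms that are the identity on `[a, ∞)`. -/
def fixGE (a : ℝ≥0) : Subgroup Homeo where
  carrier := {f | ∀ t, a ≤ t → f t = t}
  one_mem' _ _ := rfl
  mul_mem' {f g} hf hg t ht := by
    rw [Homeomorph.mul_apply, hg t ht, hf t ht]
  inv_mem' {f} hf t ht := by rw [inv_apply_eq, hf t ht]

theorem fixLE_anti {a b : ℝ≥0} (h : a ≤ b) : fixLE b ≤ fixLE a :=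
  fun _ hf t ht => hf t (ht.trans h)

theorem fixGE_mono {a b : ℝ≥0} (h : a ≤ b) : fixGE a ≤ fixGE b :=
  fun _ hf t ht => hf t (h.trans ht)

theorem commute_of_disjoint {f g : Homeo} {a : ℝ≥0} (hf : f ∈ increasing) (hg : g ∈ increasing)
    (hfa : f ∈ fixGE a) (hga : g ∈ fixLE a) : f * g = g * f := by
  ext1 t
  have hf : StrictMono f := hf
  have hg : StrictMono g := hg
  simp only [Homeomorph.mul_apply]
  rcases le_total t a with h | h
  · have h1 : f t ≤ a := by simpa [hfa a le_rfl] using hf.monotone h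
    rw [hga t h, hga _ h1]
  · have h1 : a ≤ g t := by simpa [hga a le_rfl] using hg.monotone h
    rw [hfa t h, hfa _ h1]

theorem conj_mem_fixLE {f g : Homeo} {a b : ℝ≥0} (hg : g ∈ increasing) (hf : f ∈ fixLE a)
    (hab : b ≤ g a) : g * f * g⁻¹ ∈ fixLE b := by
  intro t ht
  have hg : StrictMono g := hg
  have h1 : g⁻¹ t ≤ a := by rw [← hg.le_iff_le]; simpa using ht.trans hab
  simp only [Homeomorph.mul_apply]
  rw [hf _ h1, apply_inv_self']

theorem conj_mem_fixGE {f g : Homeo} {a b : ℝ≥0} (hg : g ∈ increasing) (hf : f ∈ fixGE a)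
    (hab : g a ≤ b) : g * f * g⁻¹ ∈ fixGE b := by
  intro t ht
  have hg : StrictMono g := hg
  have h1 : a ≤ g⁻¹ t := by rw [← hg.le_iff_le]; simpa using hab.trans ht
  simp only [Homeomorph.mul_apply]
  rw [hf _ h1, apply_inv_self']

/-! ### The generators -/

theorem x_apply_of_le {i : ℕ} {t : ℝ≥0} (h : t ≤ i) : x i t = t := by
  rw [x_apply, xFun, if_pos h]

theorem x_apply_of_ge {i : ℕ} {t : ℝ≥0} (h : (i : ℝ≥0) + 1 ≤ t) : x i t = t + 1 := by
  have h' : (i : ℝ) + 1 ≤ t := by exact_mod_cast h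
  rw [x_apply, ← NNReal.coe_inj, coe_xFun]
  push_cast
  split_ifs <;> linarith

theorem x_mem_fixLE {i : ℕ} {a : ℝ≥0} (h : a ≤ i) : x i ∈ fixLE a :=
  fun _ ht => x_apply_of_le (ht.trans h)

theorem x_mem_increasing (i : ℕ) : x i ∈ increasing := xFun_strictMono i

theorem x_zero_apply {t : ℝ≥0} (h : 1 ≤ t) : x 0 t = t + 1 :=
  x_apply_of_ge (by simpa using h)

theorem x_zero_pow_apply (k : ℕ) {t : ℝ≥0} (h : 1 ≤ t) : (x 0 ^ k) t = t + k := by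
  induction k with
  | zero => simp
  | succ k ih =>
    rw [pow_succ', Homeomorph.mul_apply, ih, x_zero_apply (h.trans le_self_add)]
    push_cast; ring

/-- Thompson's relations. -/
theorem x_mul_x {i j : ℕ} (h : i < j) : x i * x j = x (j + 1) * x i := by
  ext1 t
  have h : (i : ℝ) + 1 ≤ j := by exact_mod_cast h
  simp only [Homeomorph.mul_apply, x_apply]
  rw [← NNReal.coe_inj]
  simp only [coe_xFun]
  push_cast
  split_ifs <;> linarith

theorem x_conj {i j : ℕ} (h : i < j) : x i * x j * (x i)⁻¹ = x (j + 1) := by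
  rw [x_mul_x h, mul_inv_cancel_right]

theorem x_zero_pow_conj {j : ℕ} (h : 1 ≤ j) (k : ℕ) :
    x 0 ^ k * x j * (x 0 ^ k)⁻¹ = x (j + k) := by
  induction k with
  | zero => simp
  | succ k ih =>
    rw [← add_assoc, ← x_conj (i := 0) (j := j + k) (by omega), ← ih, pow_succ']
    group

theorem x_mul_inv_apply_of_le {i j : ℕ} {t : ℝ≥0} (h : t ≤ j) :
    (x i * (x j)⁻¹) t = x i t := by
  rw [Homeomorph.mul_apply, (fixLE _).inv_mem (x_mem_fixLE le_rfl) t h]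

/-- Both maps are translation by `1` far out, so they cancel there. -/
theorem x_mul_inv_mem_fixGE {i j : ℕ} (h : i ≤ j) : x i * (x j)⁻¹ ∈ fixGE (j + 2) := by
  intro t ht
  obtain ⟨s, rfl⟩ := exists_add_of_le ht
  have h1 : (x j)⁻¹ (j + 2 + s) = j + 1 + s := by
    rw [inv_apply_eq, x_apply_of_ge le_self_add]; ring
  have h2 : (i : ℝ≥0) ≤ j := by exact_mod_cast h
  rw [Homeomorph.mul_apply, h1, x_apply_of_ge]
  · ring
  · exact (add_le_add_left h2 1).trans le_self_add

theorem le_x_mul_inv_apply {i j : ℕ} (h : i ≤ j) (t : ℝ≥0) : t ≤ (x i * (x j)⁻¹) t := by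
  obtain ⟨s, rfl⟩ := (x j).surjective t
  have h1 : (x i * (x j)⁻¹) (x j s) = x i s := by simp
  rw [h1]
  have h : (i : ℝ) ≤ j := by exact_mod_cast h
  rw [← NNReal.coe_le_coe, x_apply, x_apply, coe_xFun, coe_xFun]
  split_ifs <;> linarith

/-! ### Bumps -/

/-- The subgroup generated by the elements `x_{i + 1} x_i⁻¹`, `i ≥ 1`. -/
def E : Subgroup Homeo :=
  Subgroup.closure (Set.range fun i : ℕ => x (i + 2) * (x (i + 1))⁻¹)

theorem E_le_F : E ≤ F := by
  rw [E, Subgroup.closure_le]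
  rintro _ ⟨i, rfl⟩
  exact F.mul_mem (mem_F _) (F.inv_mem (mem_F _))

theorem E_le_increasing : E ≤ increasing := E_le_F.trans F_le_increasing

theorem E_le_fixLE : E ≤ fixLE 1 := by
  rw [E, Subgroup.closure_le]
  rintro _ ⟨i, rfl⟩
  exact (fixLE 1).mul_mem (x_mem_fixLE (by exact_mod_cast (by omega : 1 ≤ i + 2)))
    ((fixLE 1).inv_mem (x_mem_fixLE (by simp)))

theorem x_mul_inv_mem_E {i : ℕ} (hi : 1 ≤ i) (k : ℕ) : x i * (x (i + k))⁻¹ ∈ E := by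
  induction k with
  | zero => simp
  | succ k ih =>
    have h : x (i + k + 1) * (x (i + k))⁻¹ ∈ E := by
      refine Subgroup.subset_closure ⟨i + k - 1, ?_⟩
      simp only
      rw [show i + k - 1 + 2 = i + k + 1 by omega, show i + k - 1 + 1 = i + k by omega]
    have := E.mul_mem ih (E.inv_mem h)
    rw [← add_assoc]
    convert this using 1
    group

theorem x_zero_pow_conj_mem_E {f : Homeo} (hf : f ∈ E) (k : ℕ) :
    x 0 ^ k * f * (x 0 ^ k)⁻¹ ∈ E := by
  have h : E ≤ E.comap (MulAut.conj (x 0 ^ k)).toMonoidHom := by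
    conv_lhs => rw [E]
    rw [Subgroup.closure_le]
    rintro _ ⟨i, rfl⟩
    refine Subgroup.subset_closure ⟨i + k, ?_⟩
    simp only [MulEquiv.toMonoidHom_eq_coe, MonoidHom.coe_coe, map_mul, map_inv, MulAut.conj_apply]
    rw [x_zero_pow_conj (by omega), x_zero_pow_conj (by omega)]
    rw [show i + k + 2 = i + 2 + k by omega, show i + k + 1 = i + 1 + k by omega]
  exact h hf

theorem add_min_le_x_apply {a : ℕ} {q t : ℝ≥0} (hqt : q ≤ t) (haq : (a : ℝ≥0) ≤ q) :
    (t : ℝ) + min ((q : ℝ) - a) 1 ≤ (x a t : ℝ≥0) := by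
  have h1 : (q : ℝ) ≤ t := by exact_mod_cast hqt
  have h2 : (a : ℝ) ≤ q := by exact_mod_cast haq
  have h3 := min_le_left ((q : ℝ) - a) 1
  have h4 := min_le_right ((q : ℝ) - a) 1
  rw [x_apply, coe_xFun]
  split_ifs <;> linarith

/-- An element of `E` supported in `[a, b]` that increases every point and moves a given `q > a`
beyond a given bound. -/
theorem exists_bump {a : ℕ} (ha : 1 ≤ a) {q : ℝ≥0} (haq : (a : ℝ≥0) < q) (m : ℕ) :
    ∃ β ∈ E, ∃ b : ℕ, β ∈ fixLE a ∧ β ∈ fixGE b ∧ m ≤ b ∧ (∀ t, t ≤ β t) ∧ (m : ℝ≥0) < β q := by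
  set γ : Homeo := x a * (x (a + m))⁻¹ with hγ
  have hle : ∀ t, t ≤ γ t := le_x_mul_inv_apply (Nat.le_add_right a m)
  have hpow : ∀ (k : ℕ) t, t ≤ (γ ^ k) t := by
    intro k
    induction k with
    | zero => intro t; simp
    | succ k ih =>
      intro t
      rw [pow_succ', Homeomorph.mul_apply]
      exact (ih t).trans (hle _)
  have hex : ∃ k : ℕ, (m : ℝ≥0) < (γ ^ k) q := by
    by_contra! hcon
    -- As long as the orbit of `q` stays below `m`, `γ` acts on it as `x a`, which displaces every
    -- point beyond `q` by at least the fixed amount `min (q - a) 1`.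
    have hgrow : ∀ k : ℕ, (q : ℝ) + k * min ((q : ℝ) - a) 1 ≤ ((γ ^ k) q : ℝ≥0) := by
      intro k
      induction k with
      | zero => simp
      | succ k ih =>
        have h1 : (γ ^ (k + 1)) q = x a ((γ ^ k) q) := by
          rw [pow_succ', Homeomorph.mul_apply, hγ, x_mul_inv_apply_of_le]
          exact (hcon k).trans (by push_cast; exact le_add_self)
        have h2 := add_min_le_x_apply (hpow k q) haq.le
        rw [h1]
        push_cast
        linarith
    have hδ : 0 < min ((q : ℝ) - a) 1 := lt_min (sub_pos.2 (by exact_mod_cast haq)) one_pos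
    obtain ⟨k, hk⟩ := exists_nat_gt ((m : ℝ) / min ((q : ℝ) - a) 1)
    rw [div_lt_iff₀ hδ] at hk
    have h1 := hgrow k
    have h2 : (((γ ^ k) q : ℝ≥0) : ℝ) ≤ m := by exact_mod_cast hcon k
    have h3 : (0 : ℝ) ≤ q := q.2
    linarith
  obtain ⟨k, hk⟩ := hex
  refine ⟨γ ^ k, E.pow_mem (x_mul_inv_mem_E ha m) k, a + m + 2, ?_, ?_, by omega, hpow k, hk⟩
  · refine (fixLE _).pow_mem ((fixLE _).mul_mem (x_mem_fixLE le_rfl)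
      ((fixLE _).inv_mem (x_mem_fixLE ?_))) k
    simp
  · refine (fixGE _).pow_mem ?_ k
    have := x_mul_inv_mem_fixGE (Nat.le_add_right a m)
    exact_mod_cast this

/-! ### Generating pairs -/

/-- The factors `a'` and `b'` drop out of the commutator of `a * a'` with `B = y * b'`. In
`F_le_closure` they absorb everything that depends on `c`. -/
theorem commutator_eq_of_commute {G : Type*} [Group G] {a a' b' y B : G}
    (hA : Commute a' B) (hB : B = y * b') (hb : Commute a b') :
    (a * a') * B * (a * a')⁻¹ * B⁻¹ = a * y * a⁻¹ * y⁻¹ := by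
  have h1 : (a * a') * B * (a * a')⁻¹ = a * B * a⁻¹ := by
    rw [mul_assoc a, hA.eq]; group
  rw [h1, hB]
  have h2 : b' * a⁻¹ * b'⁻¹ = a⁻¹ := by
    rw [mul_inv_eq_iff_eq_mul]; exact (hb.symm.inv_right).eq
  calc a * (y * b') * a⁻¹ * (y * b')⁻¹ = a * y * (b' * a⁻¹ * b'⁻¹) * y⁻¹ := by group
    _ = _ := by rw [h2]

theorem x_commute {f : Homeo} (hf : f ∈ E) {i : ℕ} (h : f ∈ fixGE i) : Commute f (x i) :=
  commute_of_disjoint (E_le_increasing hf) (x_mem_increasing i) h (x_mem_fixLE le_rfl)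

theorem x_zero_pow_conj_mem_fixGE {f : Homeo} {a : ℝ≥0} (ha : 1 ≤ a) (hf : f ∈ fixGE a) (k : ℕ) :
    x 0 ^ k * f * (x 0 ^ k)⁻¹ ∈ fixGE (a + k) :=
  conj_mem_fixGE (increasing.pow_mem (x_mem_increasing 0) k) hf (x_zero_pow_apply k ha).le

theorem x_zero_pow_conj_mem_fixLE {f : Homeo} {a : ℝ≥0} (ha : 1 ≤ a) (hf : f ∈ fixLE a) (k : ℕ) :
    x 0 ^ k * f * (x 0 ^ k)⁻¹ ∈ fixLE (a + k) :=
  conj_mem_fixLE (increasing.pow_mem (x_mem_increasing 0) k) hf (x_zero_pow_apply k ha).ge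

/-- `x_0` together with `x_1 x_3⁻¹ c x_N` generates `F`, for `c ∈ E` supported in `[5, N - 1]`. -/
theorem F_le_closure {c : Homeo} (hc : c ∈ E) {M : ℕ} (hM : 5 ≤ M) (hc5 : c ∈ fixLE 5)
    (hcM : c ∈ fixGE M) :
    F ≤ Subgroup.closure {x 0, x 1 * (x 3)⁻¹ * c * x (M + 1)} := by
  set g := x 1 * (x 3)⁻¹ * c * x (M + 1) with hg
  set H := Subgroup.closure {x 0, g} with hH
  set N := M + 1 with hN
  have h0 : x 0 ∈ H := Subgroup.subset_closure (by simp)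
  have hgH : g ∈ H := Subgroup.subset_closure (by simp)
  have hconj : ∀ (k : ℕ) {f : Homeo}, f ∈ H → x 0 ^ k * f * (x 0 ^ k)⁻¹ ∈ H := fun k f hf =>
    H.mul_mem (H.mul_mem (H.pow_mem h0 k) hf) (H.inv_mem (H.pow_mem h0 k))
  have hconj' : ∀ (k : ℕ) {f : Homeo}, x 0 ^ k * f * (x 0 ^ k)⁻¹ ∈ H → f ∈ H := fun k f hf => by
    have := H.mul_mem (H.mul_mem (H.inv_mem (H.pow_mem h0 k)) hf) (H.pow_mem h0 k)
    convert this using 1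
    group
  set l := x 1 * (x 3)⁻¹ with hl
  have hlE : l ∈ E := x_mul_inv_mem_E le_rfl 2
  have hl5 : l ∈ fixGE 5 := by
    have := x_mul_inv_mem_fixGE (i := 1) (j := 3) (by omega)
    convert this using 2
    norm_num
  have hM' : (5 : ℝ≥0) ≤ M := by exact_mod_cast hM
  have hlc : l * c ∈ E := E.mul_mem hlE hc
  have hlcM : l * c ∈ fixGE M := (fixGE _).mul_mem (fixGE_mono hM' hl5) hcM
  have hlcN : l * c ∈ fixGE N := fixGE_mono (by simp [hN]) hlcM
  set d := x 0 ^ 1 * (l * c) * (x 0 ^ 1)⁻¹ with hd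
  have hdE : d ∈ E := x_zero_pow_conj_mem_E hlc 1
  have hdN : d ∈ fixGE N := by
    have := x_zero_pow_conj_mem_fixGE (le_trans (by norm_num) hM') hlcM 1
    convert this using 2
    simp [hN]
  have hσg : x 0 ^ 1 * g * (x 0 ^ 1)⁻¹ = d * x (N + 1) := by
    rw [hd, ← x_zero_pow_conj (j := N) (by omega) 1, hg]; group
  set B := x 0 ^ N * g * (x 0 ^ N)⁻¹ with hBdef
  set b' := (x (N + 3))⁻¹ * (x 0 ^ N * c * (x 0 ^ N)⁻¹) * x (N + N) with hb'
  -- `b'` fixes `[0, N + 3]` (see `hb'3`), so there `B` agrees with `x (N + 1)`; this interval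
  -- contains the support of `x N * (x (N + 1))⁻¹`.
  have hB : B = x (N + 1) * b' := by
    have h1 := x_zero_pow_conj (j := 1) le_rfl N
    have h3 := x_zero_pow_conj (j := 3) (by omega) N
    have h4 := x_zero_pow_conj (j := N) (by omega) N
    rw [hBdef, hb', add_comm N 1, add_comm N 3, ← h1, ← h3, ← h4, hg, hl]
    group
  have hA : g * (d * x (N + 1))⁻¹ = (x N * (x (N + 1))⁻¹) * (l * c * d⁻¹) := by
    have h1 : Commute (l * c) (x N) := x_commute hlc hlcN
    have h2 : Commute d (x N) := x_commute hdE hdN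
    have h3 : Commute d (x (N + 1)) := x_commute hdE (fixGE_mono (by simp) hdN)
    have h4 : Commute (l * c) (x (N + 1)) := x_commute hlc (fixGE_mono (by simp) hlcN)
    have h5 : Commute (l * c * d⁻¹) (x N * (x (N + 1))⁻¹) :=
      (h1.mul_left h2.inv_left).mul_right (h4.inv_right.mul_left h3.inv_left.inv_right)
    have h6 : Commute (x N * (x (N + 1))⁻¹) d⁻¹ :=
      (h2.inv_left.mul_right h3.inv_left.inv_right).symm
    calc g * (d * x (N + 1))⁻¹ = l * c * ((x N * (x (N + 1))⁻¹) * d⁻¹) := by rw [hg]; group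
      _ = (l * c * d⁻¹) * (x N * (x (N + 1))⁻¹) := by rw [h6.eq]; group
      _ = _ := h5.eq
  have hcF : c ∈ increasing := E_le_increasing hc
  have hx (i : ℕ) : x i ∈ increasing := x_mem_increasing i
  have hpow (k : ℕ) : x 0 ^ k ∈ increasing := increasing.pow_mem (hx 0) k
  have hgm : g ∈ increasing := increasing.mul_mem (E_le_increasing hlc) (hx N)
  have hBm : B ∈ increasing :=
    increasing.mul_mem (increasing.mul_mem (hpow N) hgm) (increasing.inv_mem (hpow N))
  have hN1 : (1 : ℝ≥0) ≤ N := by exact_mod_cast (by omega : 1 ≤ N)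
  have hg1 : g ∈ fixLE 1 := (fixLE 1).mul_mem (E_le_fixLE hlc) (x_mem_fixLE hN1)
  have hB1 : B ∈ fixLE N := fixLE_anti (by simp) (x_zero_pow_conj_mem_fixLE le_rfl hg1 N)
  have hcN3 : x 0 ^ N * c * (x 0 ^ N)⁻¹ ∈ fixLE (N + 3) := by
    refine fixLE_anti ?_ (x_zero_pow_conj_mem_fixLE (by norm_num) hc5 N)
    rw [add_comm]
    gcongr
    norm_num
  have hb'3 : b' ∈ fixLE (N + 3) := by
    refine (fixLE _).mul_mem ((fixLE _).mul_mem ((fixLE _).inv_mem (x_mem_fixLE ?_)) hcN3)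
      (x_mem_fixLE ?_)
    · push_cast; exact le_rfl
    · exact_mod_cast (by omega : N + 3 ≤ N + N)
  have hb'm : b' ∈ increasing :=
    increasing.mul_mem (increasing.mul_mem (increasing.inv_mem (hx _)) (increasing.mul_mem
      (increasing.mul_mem (hpow N) hcF) (increasing.inv_mem (hpow N)))) (hx _)
  have ha3 : x N * (x (N + 1))⁻¹ ∈ fixGE (N + 3) := by
    have := x_mul_inv_mem_fixGE (i := N) (j := N + 1) (by omega)
    convert this using 2
    push_cast; ring
  have hcomm1 : Commute (l * c * d⁻¹) B :=
    commute_of_disjoint (E_le_increasing (E.mul_mem hlc (E.inv_mem hdE))) hBm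
      ((fixGE _).mul_mem hlcN ((fixGE _).inv_mem hdN)) hB1
  have hcomm2 : Commute (x N * (x (N + 1))⁻¹) b' :=
    commute_of_disjoint (increasing.mul_mem (hx _) (increasing.inv_mem (hx _))) hb'm ha3 hb'3
  have hkey := commutator_eq_of_commute hcomm1 hB hcomm2
  have hAH : (x N * (x (N + 1))⁻¹) * (l * c * d⁻¹) ∈ H := by
    rw [← hA, ← hσg]
    exact H.mul_mem hgH (H.inv_mem (hconj 1 hgH))
  have hBH : B ∈ H := hconj N hgH
  -- With `a = x N * y⁻¹` and `y = x (N + 1)`, the commutator of `a` and `y` equals that of `x N`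
  -- and `y`, which Thompson's relation evaluates.
  have he : x (N + 2) * (x (N + 1))⁻¹ ∈ H := by
    have h1 := H.mul_mem (H.mul_mem (H.mul_mem hAH hBH) (H.inv_mem hAH)) (H.inv_mem hBH)
    rw [hkey] at h1
    convert h1 using 1
    rw [← x_conj (i := N) (j := N + 1) (by omega)]
    group
  have he1 : x 2 * (x 1)⁻¹ ∈ H := by
    refine hconj' N ?_
    convert he using 1
    rw [add_comm N, add_comm N, ← x_zero_pow_conj (j := 1) le_rfl N,
      ← x_zero_pow_conj (j := 2) (by omega) N]
    group
  have hEH : E ≤ H := by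
    rw [E, Subgroup.closure_le]
    rintro _ ⟨i, rfl⟩
    have := hconj i he1
    simp only [SetLike.mem_coe]
    convert this using 1
    rw [add_comm i, add_comm i, ← x_zero_pow_conj (j := 1) le_rfl i,
      ← x_zero_pow_conj (j := 2) (by omega) i]
    group
  have hxN : x N ∈ H := by
    have := H.mul_mem (H.inv_mem (hEH hlc)) hgH
    rwa [hg, inv_mul_cancel_left] at this
  have hx1 : x 1 ∈ H := by
    refine hconj' M ?_
    rwa [x_zero_pow_conj le_rfl, add_comm]
  rw [F, Subgroup.closure_le]
  rintro _ ⟨i, rfl⟩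
  rcases Nat.eq_zero_or_pos i with rfl | hi
  · exact h0
  · have := hconj (i - 1) hx1
    rwa [x_zero_pow_conj le_rfl, show 1 + (i - 1) = i by omega] at this

/-! ### No laws -/

/-- The value of a signed letter. -/
abbrev letter {α G : Type*} [Group G] (h : α → G) (l : α × Bool) : G :=
  bif l.2 then h l.1 else (h l.1)⁻¹

theorem lift_mk_cons {α G : Type*} [Group G] (h : α → G) (l : α × Bool) (L : List (α × Bool)) :
    FreeGroup.lift h (FreeGroup.mk (l :: L)) = letter h l * FreeGroup.lift h (FreeGroup.mk L) := by
  simp [FreeGroup.lift_mk]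

theorem lift_mem {α G : Type*} [Group G] {S : Subgroup G} {h : α → G} (hS : ∀ z, h z ∈ S)
    (v : FreeGroup α) : FreeGroup.lift h v ∈ S := by
  have : (FreeGroup.lift h).range ≤ S := by
    apply FreeGroup.range_lift_le
    rintro _ ⟨z, rfl⟩
    exact hS z
  exact this ⟨v, rfl⟩

/-- If `h'` agrees with `h` up to `B` then it has the same effect on points whose image under the
letter, or its inverse, stays below `B`. -/
theorem letter_apply_congr {α : Type*} {h h' : α → Homeo} {y : α} {b : Bool} {B q : ℝ≥0}
    (hm : h y ∈ increasing) (hB : h y ∈ fixGE B) (hq : q ≤ B)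
    (hag : ∀ t, t ≤ B → h' y t = h y t) : letter h' (y, b) q = letter h (y, b) q := by
  cases b
  · simp only [letter, cond_false]
    rw [inv_apply_eq, hag, apply_inv_self']
    have := apply_le_apply (increasing.inv_mem hm) hq
    rwa [(fixGE B).inv_mem hB B le_rfl] at this
  · exact hag q hq

/-- The data of a trajectory that starts at `2`, follows the word `L` and ends in `q`: the
trajectory depends on `h z` on `[0, B z]` only, and a letter that does not cancel the head of `L`
can be chosen freely beyond `q`. -/
structure Trajectory {α : Type*} (L : List (α × Bool)) (h : α → Homeo) (B : α → ℕ) (m : ℕ)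
    (q : ℝ≥0) : Prop where
  mem_E : ∀ z, h z ∈ E
  fixGE : ∀ z, h z ∈ fixGE (B z)
  one_le : ∀ z, 1 ≤ B z
  bound : ∀ z, B z ≤ m
  two_le : 2 ≤ q
  two_lt : L ≠ [] → 2 < q
  free : ∀ z, (∀ l ∈ L.head?, l.1 ≠ z) → (B z : ℝ≥0) < q
  head : ∀ l ∈ L.head?, q ≤ B l.1 ∧ ∀ t, q ≤ t → t ≤ letter h l t
  eval : ∀ h' : α → Homeo, (∀ z t, t ≤ (B z : ℝ≥0) → h' z t = h z t) →
    FreeGroup.lift h' (FreeGroup.mk L) 2 = q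

/-- A repeated letter needs no new choice: it moves all points beyond `q` to the right or fixes
them, and it keeps the trajectory within `B`. -/
theorem Trajectory.cons_same {α : Type*} {L : List (α × Bool)} {h : α → Homeo} {B : α → ℕ} {m : ℕ}
    {q : ℝ≥0} (T : Trajectory L h B m q) {l : α × Bool} (hl : l ∈ L.head?) :
    Trajectory (l :: L) h B m (letter h l q) := by
  obtain ⟨y, b⟩ := l
  obtain ⟨h1, h2⟩ := T.head _ hl
  have hlt : letter h (y, b) ∈ increasing ⊓ ThompsonF.fixGE (B y) := by
    have h3 : h y ∈ increasing ⊓ ThompsonF.fixGE (B y) :=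
      ⟨E_le_increasing (T.mem_E y), T.fixGE y⟩
    cases b
    · exact Subgroup.inv_mem _ h3
    · exact h3
  have hq := h2 q le_rfl
  have hL : L ≠ [] := by rintro rfl; simp at hl
  refine ⟨T.mem_E, T.fixGE, T.one_le, T.bound, T.two_le.trans hq, fun _ => (T.two_lt hL).trans_le hq,
    ?_, ?_, ?_⟩
  · intro z hz
    refine (T.free z ?_).trans_le hq
    intro l hl'
    obtain rfl := Option.mem_unique hl hl'
    exact hz _ (by simp)
  · intro l hl'
    obtain rfl : (y, b) = l := by simpa using hl'
    refine ⟨?_, fun t ht => h2 t (hq.trans ht)⟩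
    have := apply_le_apply hlt.1 h1
    rwa [hlt.2 _ le_rfl] at this
  · intro h' hag
    rw [lift_mk_cons, Homeomorph.mul_apply, T.eval h' hag]
    exact letter_apply_congr (E_le_increasing (T.mem_E y)) (T.fixGE y) h1 (hag y)

/-- The current point lies beyond the bound `B` of the new generator, so that generator can be
extended by a bump there without disturbing the earlier trajectory. The bump carries the point
beyond the bounds of all other generators. -/
theorem Trajectory.cons_new {α : Type*} [DecidableEq α] {L : List (α × Bool)} {h : α → Homeo}
    {B : α → ℕ} {m : ℕ} {q : ℝ≥0} (T : Trajectory L h B m q) {l : α × Bool}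
    (hl : ∀ l' ∈ L.head?, l'.1 ≠ l.1) : ∃ h B m q, Trajectory (l :: L) h B m q := by
  obtain ⟨y, b⟩ := l
  obtain ⟨k, hk⟩ := exists_nat_ge q
  -- Passing `m` clears every old bound `B z`; passing `k ≥ q` makes the move strict.
  obtain ⟨β, hβE, c, hβ1, hβ2, hmc, hβle, hβq⟩ :=
    exists_bump (T.one_le y) (T.free y hl) (max m k)
  have hβm : StrictMono β := E_le_increasing hβE
  have hq : q < β q := lt_of_le_of_lt (hk.trans (by simp)) hβq
  have hBy : (B y : ℝ≥0) < q := T.free y hl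
  have hBm : ∀ z, (B z : ℝ≥0) < β q := fun z =>
    lt_of_le_of_lt (by exact_mod_cast (T.bound z).trans (le_max_left _ _)) hβq
  have hqc : q ≤ c := hk.trans (by exact_mod_cast (le_max_right _ _).trans hmc)
  have hβqc : β q ≤ c := by simpa [hβ2 c le_rfl] using hβm.monotone hqc
  have hBc : ∀ z, B z ≤ c := fun z => (T.bound z).trans ((le_max_left _ _).trans hmc)
  set γ : Homeo := bif b then β else β⁻¹ with hγ
  have hγmem : ∀ {S : Subgroup Homeo}, β ∈ S → γ ∈ S := fun hS => by
    cases b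
    · exact Subgroup.inv_mem _ hS
    · exact hS
  set h₁ : α → Homeo := Function.update h y (h y * γ) with hh₁
  set B₁ : α → ℕ := Function.update B y c with hB₁
  have hh₁y : h₁ y = h y * γ := Function.update_self ..
  have hB₁y : B₁ y = c := Function.update_self ..
  have hh₁z : ∀ z, z ≠ y → h₁ z = h z := fun z hz => Function.update_of_ne hz ..
  have hB₁z : ∀ z, z ≠ y → B₁ z = B z := fun z hz => Function.update_of_ne hz ..
  have hc : (B y : ℝ≥0) ≤ c := by exact_mod_cast hBc y
  have hlet : ∀ t, q ≤ t → letter h₁ (y, b) t = β t := by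
    intro t ht
    have h1 : (B y : ℝ≥0) ≤ t := hBy.le.trans ht
    cases b
    · simp only [letter, cond_false, hh₁y, hγ, mul_inv_rev, inv_inv, Homeomorph.mul_apply]
      rw [(ThompsonF.fixGE _).inv_mem (T.fixGE y) t h1]
    · simp only [letter, cond_true, hh₁y, hγ, Homeomorph.mul_apply]
      rw [T.fixGE y _ (h1.trans (hβle t))]
  have hmem : ∀ z, h₁ z ∈ E := by
    intro z
    by_cases hz : z = y
    · subst hz; rw [hh₁y]; exact E.mul_mem (T.mem_E z) (hγmem hβE)
    · rw [hh₁z z hz]; exact T.mem_E z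
  have hfix : ∀ z, h₁ z ∈ ThompsonF.fixGE (B₁ z) := by
    intro z
    by_cases hz : z = y
    · subst hz; rw [hh₁y, hB₁y]
      exact (ThompsonF.fixGE _).mul_mem (fixGE_mono hc (T.fixGE z)) (hγmem hβ2)
    · rw [hh₁z z hz, hB₁z z hz]; exact T.fixGE z
  refine ⟨h₁, B₁, c, β q, hmem, hfix, ?_, ?_, T.two_le.trans hq.le, fun _ => T.two_le.trans_lt hq,
    ?_, ?_, ?_⟩
  · intro z
    by_cases hz : z = y
    · subst hz; rw [hB₁y]; exact (T.one_le z).trans (hBc z)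
    · rw [hB₁z z hz]; exact T.one_le z
  · intro z
    by_cases hz : z = y
    · subst hz; rw [hB₁y]
    · rw [hB₁z z hz]; exact hBc z
  · intro z hz
    have hz : z ≠ y := fun h => hz (y, b) (by simp) h.symm
    rw [hB₁z z hz]; exact hBm z
  · intro l' hl'
    obtain rfl : (y, b) = l' := by simpa using hl'
    refine ⟨by simpa [hB₁y] using hβqc, fun t ht => ?_⟩
    rw [hlet t (hq.le.trans ht)]
    exact hβle t
  · intro h' hag
    have hag' : ∀ z t, t ≤ (B z : ℝ≥0) → h' z t = h z t := by
      intro z t ht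
      by_cases hz : z = y
      · subst hz
        rw [hag z t (by rw [hB₁y]; exact ht.trans hc), hh₁y, Homeomorph.mul_apply,
          hγmem hβ1 t ht]
      · rw [hag z t (by rwa [hB₁z z hz]), hh₁z z hz]
    rw [lift_mk_cons, Homeomorph.mul_apply, T.eval h' hag', ← hlet q le_rfl]
    exact letter_apply_congr (E_le_increasing (hmem y)) (hfix y) (by rw [hB₁y]; exact hqc) (hag y)

theorem exists_trajectory {α : Type*} [DecidableEq α] {L : List (α × Bool)}
    (hL : FreeGroup.IsReduced L) : ∃ h B m q, Trajectory L h B m q := by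
  induction L with
  | nil =>
    -- The starting point `2` is beyond the initial bound `1`, so every generator is still free.
    refine ⟨1, 1, 1, 2, fun _ => E.one_mem, fun _ => Subgroup.one_mem _, fun _ => le_rfl,
      fun _ => le_rfl, le_rfl, fun h => (h rfl).elim, fun _ _ => by norm_num, by simp, ?_⟩
    intro h' _
    rw [← FreeGroup.one_eq_mk, map_one]
    rfl
  | cons l L ih =>
    have hred : ∀ l' ∈ L.head?, l.1 = l'.1 → l.2 = l'.2 := (List.isChain_cons.1 hL).1
    obtain ⟨h, B, m, q, T⟩ := ih (List.isChain_cons.1 hL).2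
    by_cases hl : l ∈ L.head?
    -- In a reduced word, adjacent letters with the same generator have the same sign; so the new
    -- letter either repeats the head or has another generator.
    · exact ⟨_, _, _, _, T.cons_same hl⟩
    · refine T.cons_new fun l' hl' heq => hl ?_
      rwa [Prod.ext heq.symm (hred l' hl' heq.symm)]

/-- The elements of `E` that are supported in `[1, 2]`. -/
def E₁₂ : Subgroup Homeo := E ⊓ fixGE 2

/-- `E₁₂` satisfies no law. -/
theorem exists_lift_ne {α : Type*} [DecidableEq α] {v : FreeGroup α} (hv : v ≠ 1) :
    ∃ h : α → Homeo, (∀ z, h z ∈ E₁₂) ∧ ∃ p, 1 ≤ p ∧ p ≤ 2 ∧ FreeGroup.lift h v p ≠ p := by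
  obtain ⟨h, B, m, q, T⟩ := exists_trajectory (FreeGroup.isReduced_toWord (x := v))
  have hvL : v.toWord ≠ [] := by rwa [Ne, FreeGroup.toWord_eq_nil_iff]
  have hev : FreeGroup.lift h v 2 = q := by
    simpa [FreeGroup.mk_toWord] using T.eval h fun _ _ _ => rfl
  -- Conjugation by `κ⁻¹` squeezes the supports, which lie in `[1, m]`, into `[1, 2]`.
  obtain ⟨κ, hκE, _, hκ1, -, -, hκle, hκ⟩ := exists_bump (a := 1) le_rfl (q := 2) (by norm_num) m
  have hκm : κ⁻¹ ∈ increasing := E_le_increasing (E.inv_mem hκE)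
  have hκ1' : κ⁻¹ 1 = 1 := (fixLE _).inv_mem hκ1 1 (by simp)
  have hκ2 : κ⁻¹ m ≤ 2 := by
    rw [← (show StrictMono κ from E_le_increasing hκE).le_iff_le, apply_inv_self']
    exact hκ.le
  have hlift : FreeGroup.lift (fun z => κ⁻¹ * h z * κ) v = κ⁻¹ * FreeGroup.lift h v * κ := by
    have : FreeGroup.lift (fun z => κ⁻¹ * h z * κ) =
        (MulAut.conj κ⁻¹).toMonoidHom.comp (FreeGroup.lift h) := by
      ext1 z; simp
    rw [this]; simp
  refine ⟨fun z => κ⁻¹ * h z * κ, fun z => ⟨?_, ?_⟩, κ⁻¹ 2, ?_, ?_, ?_⟩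
  · exact E.mul_mem (E.mul_mem (E.inv_mem hκE) (T.mem_E z)) hκE
  · have := conj_mem_fixGE hκm (T.fixGE z) (b := 2)
      ((apply_le_apply hκm (Nat.cast_le.2 (T.bound z))).trans hκ2)
    simpa using this
  · have := apply_le_apply hκm (show (1 : ℝ≥0) ≤ 2 by norm_num)
    rwa [hκ1'] at this
  · rw [← (show StrictMono κ from E_le_increasing hκE).le_iff_le, apply_inv_self']
    exact hκle 2
  · rw [hlift]
    simp only [Homeomorph.mul_apply, apply_inv_self', hev]
    exact fun h => (T.two_lt hvL).ne' (κ⁻¹.injective h)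

/-! ### Words in two generators -/

theorem E₁₂_apply {f : Homeo} (hf : f ∈ E₁₂) {p : ℝ≥0} (h1 : 1 ≤ p) (h2 : p ≤ 2) :
    1 ≤ f p ∧ f p ≤ 2 := by
  have hm := E_le_increasing hf.1
  have h3 := apply_le_apply hm h1
  have h4 := apply_le_apply hm h2
  rw [E_le_fixLE hf.1 1 le_rfl] at h3
  rw [hf.2 2 le_rfl] at h4
  exact ⟨h3, h4⟩

/-- Prescribed elements of `E₁₂` can be placed in consecutive unit intervals. -/
theorem exists_windows {u : ℕ → Homeo} (hu : ∀ i, u i ∈ E₁₂) (a m : ℕ) :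
    ∃ c ∈ E, c ∈ fixLE (a + 1) ∧ c ∈ fixGE (a + m + 1) ∧ ∀ i < m, ∀ p, 1 ≤ p → p ≤ 2 →
      c ((x 0 ^ (a + i)) p) = (x 0 ^ (a + i)) (u i p) := by
  induction m with
  | zero => exact ⟨1, E.one_mem, Subgroup.one_mem _, Subgroup.one_mem _, by simp⟩
  | succ m ih =>
    obtain ⟨c, hc, hc1, hc2, hcu⟩ := ih
    have hd1 := x_zero_pow_conj_mem_fixLE le_rfl (E_le_fixLE (hu m).1) (a + m)
    have hd2 := x_zero_pow_conj_mem_fixGE (by norm_num) (hu m).2 (a + m)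
    refine ⟨c * (x 0 ^ (a + m) * u m * (x 0 ^ (a + m))⁻¹),
      E.mul_mem hc (x_zero_pow_conj_mem_E (hu m).1 _), (fixLE _).mul_mem hc1 (fixLE_anti ?_ hd1),
      (fixGE _).mul_mem (fixGE_mono ?_ hc2) (fixGE_mono ?_ hd2), ?_⟩
    · exact_mod_cast (by omega : a + 1 ≤ 1 + (a + m))
    · exact_mod_cast (by omega : a + m + 1 ≤ a + (m + 1) + 1)
    · exact_mod_cast (by omega : 2 + (a + m) ≤ a + (m + 1) + 1)
    · intro i hi p hp1 hp2
      rcases Nat.lt_succ_iff_lt_or_eq.1 hi with hi | rfl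
      · rw [Homeomorph.mul_apply, hd1, hcu i hi p hp1 hp2]
        rw [x_zero_pow_apply _ hp1]
        calc p + ((a + i : ℕ) : ℝ≥0) ≤ 2 + ((a + i : ℕ) : ℝ≥0) := by gcongr
          _ ≤ 1 + ((a + m : ℕ) : ℝ≥0) := by exact_mod_cast (by omega)
      · have h1 := (E₁₂_apply (hu i) hp1 hp2).1
        simp only [Homeomorph.mul_apply]
        rw [inv_apply_eq.2 rfl, hc2]
        rw [x_zero_pow_apply _ h1, add_comm (u i p)]
        push_cast
        gcongr

/-- The generators of the free group of rank `2` acting on pairs of an integer and a word in letters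
indexed by the integers: the first shifts the integer `j`, the second multiplies the word by the
letter `j`. -/
def wordAction : FreeGroup (Fin 2) →* Equiv.Perm (ℤ × FreeGroup ℤ) :=
  FreeGroup.lift ![(Equiv.addRight 1).prodCongr (Equiv.refl _),
    Equiv.prodShear (Equiv.refl _) fun j => Equiv.mulLeft (FreeGroup.of j)]

theorem wordAction_zero (s : ℤ × FreeGroup ℤ) :
    wordAction (FreeGroup.of 0) s = (s.1 + 1, s.2) := by
  simp [wordAction, Prod.map]

theorem wordAction_one (s : ℤ × FreeGroup ℤ) :
    wordAction (FreeGroup.of 1) s = (s.1, FreeGroup.of s.1 * s.2) := by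
  simp [wordAction]

theorem wordAction_zero_inv (s : ℤ × FreeGroup ℤ) :
    wordAction (FreeGroup.of 0)⁻¹ s = (s.1 - 1, s.2) := by
  rw [map_inv, Equiv.Perm.inv_eq_iff_eq, wordAction_zero]
  simp

theorem wordAction_one_inv (s : ℤ × FreeGroup ℤ) :
    wordAction (FreeGroup.of 1)⁻¹ s = (s.1, (FreeGroup.of s.1)⁻¹ * s.2) := by
  rw [map_inv, Equiv.Perm.inv_eq_iff_eq, wordAction_one]
  simp

/-- The word that moves the base point of `wordAction` to a given point. -/
def readWord (s : ℤ × FreeGroup ℤ) : FreeGroup (Fin 2) :=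
  FreeGroup.of 0 ^ s.1 *
    FreeGroup.lift (fun i : ℤ => FreeGroup.of 0 ^ (-i) * FreeGroup.of 1 * FreeGroup.of 0 ^ i) s.2

/-- Equivariance of `readWord` for left multiplication: the image of the base point determines the
word, so only the trivial word fixes it. -/
theorem readWord_wordAction (w : FreeGroup (Fin 2)) :
    ∀ s, readWord (wordAction w s) = w * readWord s := by
  have hof : ∀ (i : Fin 2) s,
      readWord (wordAction (FreeGroup.of i) s) = FreeGroup.of i * readWord s := by
    rw [Fin.forall_fin_two]
    constructor
    · intro s
      rw [wordAction_zero, readWord, readWord]; group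
    · intro s
      rw [wordAction_one, readWord, readWord, map_mul, FreeGroup.lift_apply_of]; group
  induction w using FreeGroup.induction_on with
  | C1 => simp
  | of i => exact hof i
  | inv_of i _ =>
    intro s
    have := hof i (wordAction (FreeGroup.of i)⁻¹ s)
    rw [← Equiv.Perm.mul_apply, ← map_mul, mul_inv_cancel, map_one, Equiv.Perm.one_apply] at this
    rw [this, inv_mul_cancel_left]
  | mul v w hv hw =>
    intro s
    rw [map_mul, Equiv.Perm.mul_apply, hv, hw, mul_assoc]

theorem wordAction_ne {w : FreeGroup (Fin 2)} (hw : w ≠ 1) : wordAction w (0, 1) ≠ (0, 1) := by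
  intro h
  have := readWord_wordAction w (0, 1)
  rw [h] at this
  exact hw (by simpa using this)

/-- A word in `x_0` and an element `g` that acts on consecutive unit intervals by `θ j` is evaluated
by means of `wordAction`. -/
theorem lift_apply_window {θ : ℤ → Homeo} (hθ : ∀ j, θ j ∈ E₁₂) {b : ℤ} {n : ℕ} {g : Homeo}
    (hg : ∀ j : ℤ, |j| ≤ n → ∀ p, 1 ≤ p → p ≤ 2 →
      g ((x 0 ^ (b + j)) p) = (x 0 ^ (b + j)) (θ j p))
    {p : ℝ≥0} (h1 : 1 ≤ p) (h2 : p ≤ 2) (L : List (Fin 2 × Bool)) (hL : L.length ≤ n) :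
    |(wordAction (FreeGroup.mk L) (0, 1)).1| ≤ L.length ∧
    FreeGroup.lift ![x 0, g] (FreeGroup.mk L) ((x 0 ^ b) p) =
      (x 0 ^ (b + (wordAction (FreeGroup.mk L) (0, 1)).1))
        (FreeGroup.lift θ (wordAction (FreeGroup.mk L) (0, 1)).2 p) := by
  induction L with
  | nil => simp [← FreeGroup.one_eq_mk]
  | cons l L ih =>
    rw [List.length_cons] at hL
    obtain ⟨hlen, hev⟩ := ih (by omega)
    have hmk : wordAction (FreeGroup.mk (l :: L)) (0, 1) =
        wordAction (letter FreeGroup.of l) (wordAction (FreeGroup.mk L) (0, 1)) := by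
      have := lift_mk_cons FreeGroup.of l L
      rw [FreeGroup.lift_of_eq_id] at this
      simp only [MonoidHom.id_apply] at this
      rw [this, map_mul, Equiv.Perm.mul_apply]
    rw [hmk, lift_mk_cons, Homeomorph.mul_apply, hev]
    generalize wordAction (FreeGroup.mk L) (0, 1) = s at hlen ⊢
    obtain ⟨j, v⟩ := s
    simp only at hlen ⊢
    have hjn : |j| ≤ n := hlen.trans (by omega)
    have hv : FreeGroup.lift θ v ∈ E₁₂ := lift_mem hθ v
    obtain ⟨hq1, hq2⟩ := E₁₂_apply hv h1 h2
    rw [abs_le] at hlen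
    obtain ⟨i, ε⟩ := l
    fin_cases i <;> cases ε <;>
      simp only [letter, cond_true, cond_false, Fin.zero_eta, Fin.mk_one, wordAction_zero,
        wordAction_one, wordAction_zero_inv, wordAction_one_inv, Matrix.cons_val_zero,
        Matrix.cons_val_one, List.length_cons, abs_le]
    · refine ⟨by omega, ?_⟩
      rw [← add_sub_assoc, zpow_sub_one, ← Homeomorph.mul_apply, ← (Commute.self_zpow _ _).inv_left.eq]
    · refine ⟨by omega, ?_⟩
      rw [← add_assoc, zpow_add_one, ← Homeomorph.mul_apply, (Commute.self_zpow _ _).eq]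
    · refine ⟨by omega, ?_⟩
      obtain ⟨hr1, hr2⟩ := E₁₂_apply (E₁₂.inv_mem (hθ j)) hq1 hq2
      rw [inv_apply_eq, map_mul, Homeomorph.mul_apply, map_inv, FreeGroup.lift_apply_of,
        hg j hjn _ hr1 hr2, apply_inv_self']
    · refine ⟨by omega, ?_⟩
      rw [map_mul, Homeomorph.mul_apply, FreeGroup.lift_apply_of, hg j hjn _ hq1 hq2]

/-- The offset `a` allows the block that detects `w` to be placed arbitrarily far to the right, and
only the values of `g` on that block matter. -/
theorem exists_lift_ne_one {w : FreeGroup (Fin 2)} (hw : w ≠ 1) (a : ℕ) :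
    ∃ m : ℕ, ∃ c ∈ E, c ∈ fixLE (a + 1) ∧ c ∈ fixGE (a + m + 1) ∧ ∀ g : Homeo,
      (∀ t : ℝ≥0, a + 1 ≤ t → t ≤ a + m + 1 → g t = c t) → FreeGroup.lift ![x 0, g] w ≠ 1 := by
  set n := w.toWord.length with hn
  have hne := wordAction_ne hw
  obtain ⟨θ, hθ, p, h1, h2, hp⟩ : ∃ θ : ℤ → Homeo, (∀ j, θ j ∈ E₁₂) ∧ ∃ p, 1 ≤ p ∧ p ≤ 2 ∧
      ((wordAction w (0, 1)).1 = 0 → FreeGroup.lift θ (wordAction w (0, 1)).2 p ≠ p) ∧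
      ((wordAction w (0, 1)).1 ≠ 0 → FreeGroup.lift θ (wordAction w (0, 1)).2 p = p) := by
    by_cases hj : (wordAction w (0, 1)).1 = 0
    · obtain ⟨θ, hθ, p, h1, h2, hp⟩ := exists_lift_ne
        (v := (wordAction w (0, 1)).2) (fun hv => hne (Prod.ext hj hv))
      exact ⟨θ, hθ, p, h1, h2, fun _ => hp, fun h => (h hj).elim⟩
    -- With nonzero net shift the trivial choice works: the translation alone moves the point.
    · refine ⟨1, fun _ => E₁₂.one_mem, 1, le_rfl, one_le_two, fun h => (hj h).elim, fun _ => ?_⟩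
      exact E_le_fixLE (lift_mem (S := E₁₂) (fun _ => E₁₂.one_mem) _).1 1 le_rfl
  obtain ⟨c, hc, hc1, hc2, hcu⟩ :=
    -- A word of length `n` that starts in the middle window visits only the shifts `-n, …, n`,
    -- hence `2 * n + 1` windows.
    exists_windows (u := fun i => θ ((i : ℤ) - n)) (fun _ => hθ _) a (2 * n + 1)
  refine ⟨2 * n + 1, c, hc, hc1, hc2, fun g hg hw1 => ?_⟩
  have hwin : ∀ j : ℤ, |j| ≤ n → ∀ p, 1 ≤ p → p ≤ 2 →
      g ((x 0 ^ (((a + n : ℕ) : ℤ) + j)) p) = (x 0 ^ (((a + n : ℕ) : ℤ) + j)) (θ j p) := by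
    intro j hj p h1 h2
    rw [abs_le] at hj
    obtain ⟨i, hi⟩ : ∃ i : ℕ, (i : ℤ) = n + j := ⟨(n + j).toNat, by omega⟩
    have e1 : ((a + n : ℕ) : ℤ) + j = (a + i : ℕ) := by push_cast; omega
    have e2 : j = (i : ℤ) - n := by omega
    have hpt := x_zero_pow_apply (a + i) h1
    rw [e1, zpow_natCast, hg, hcu i (by omega) p h1 h2, e2]
    · rw [hpt]
      calc (a : ℝ≥0) + 1 ≤ 1 + ((a + i : ℕ) : ℝ≥0) := by exact_mod_cast (by omega)
        _ ≤ _ := by gcongr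
    · rw [hpt]
      calc p + ((a + i : ℕ) : ℝ≥0) ≤ 2 + ((a + i : ℕ) : ℝ≥0) := by gcongr
        _ ≤ _ := by exact_mod_cast (by omega)
  obtain ⟨hlen, hev⟩ := lift_apply_window hθ hwin h1 h2 w.toWord le_rfl
  rw [FreeGroup.mk_toWord] at hlen hev
  rw [hw1, Homeomorph.one_apply] at hev
  by_cases hj : (wordAction w (0, 1)).1 = 0
  · rw [hj, add_zero] at hev
    exact hp.1 hj ((x 0 ^ ((a + n : ℕ) : ℤ)).injective hev).symm
  · rw [hp.2 hj] at hev
    generalize (wordAction w (0, 1)).1 = j at *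
    rw [abs_le] at hlen
    obtain ⟨i, hi⟩ : ∃ i : ℕ, (i : ℤ) = (a + n : ℕ) + j := ⟨((a + n : ℕ) + j).toNat, by omega⟩
    rw [← hi, zpow_natCast, zpow_natCast, x_zero_pow_apply _ h1, x_zero_pow_apply _ h1,
      add_right_inj, Nat.cast_inj] at hev
    omega

/-- Each new word receives a block to the right of the old ones. As each word is detected within its
own block, the blocks do not interfere. The left end `5` is where the support of `x 1 * (x 3)⁻¹`
ends. -/
theorem exists_forall_lift_ne_one (S : Finset (FreeGroup (Fin 2))) :
    ∃ m : ℕ, 5 ≤ m ∧ ∃ c ∈ E, c ∈ fixLE 5 ∧ c ∈ fixGE m ∧ ∀ g : Homeo,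
      (∀ t : ℝ≥0, 5 ≤ t → t ≤ m → g t = c t) →
        ∀ w ∈ S, w ≠ 1 → FreeGroup.lift ![x 0, g] w ≠ 1 := by
  induction S using Finset.induction_on with
  | empty => exact ⟨5, le_rfl, 1, E.one_mem, Subgroup.one_mem _, Subgroup.one_mem _, by simp⟩
  | insert w S _ ih =>
    obtain ⟨m, hm, c, hc, hc5, hcm, hcS⟩ := ih
    by_cases hw : w = 1
    · refine ⟨m, hm, c, hc, hc5, hcm, fun g hg v hv hv1 => ?_⟩
      rcases Finset.mem_insert.1 hv with rfl | hv
      · exact (hv1 hw).elim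
      · exact hcS g hg v hv hv1
    -- The offset `m - 1` makes the new block start exactly at `m`.
    obtain ⟨k, d, hd, hd1, hd2, hdw⟩ := exists_lift_ne_one hw (m - 1)
    have hm1 : ((m - 1 : ℕ) : ℝ≥0) + 1 = m := by exact_mod_cast (by omega : m - 1 + 1 = m)
    have hmk : ((m - 1 : ℕ) : ℝ≥0) + k + 1 = (m + k : ℕ) := by
      rw [add_right_comm, hm1]; push_cast; rfl
    rw [hm1] at hd1 hdw
    rw [hmk] at hd2 hdw
    have hm5 : (5 : ℝ≥0) ≤ m := by exact_mod_cast hm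
    refine ⟨m + k, by omega, c * d, E.mul_mem hc hd, (fixLE _).mul_mem hc5 (fixLE_anti hm5 hd1),
      (fixGE _).mul_mem (fixGE_mono (by simp) hcm) hd2, fun g hg v hv hv1 => ?_⟩
    rcases Finset.mem_insert.1 hv with rfl | hv
    · refine hdw g fun t ht1 ht2 => ?_
      have h1 := apply_le_apply (E_le_increasing hd) ht1
      rw [hd1 _ le_rfl] at h1
      rw [hg t (hm5.trans ht1) ht2, Homeomorph.mul_apply, hcm _ h1]
    · refine hcS g (fun t ht1 ht2 => ?_) v hv hv1
      rw [hg t ht1 (ht2.trans (by simp)), Homeomorph.mul_apply, hd1 t ht2]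

theorem exists_generating_pair (n : ℕ) : ∃ X₀ X₁ : F, Subgroup.closure {X₀, X₁} = ⊤ ∧
    ∀ w : FreeGroup (Fin 2), w ≠ 1 → w.norm ≤ n → FreeGroup.lift ![X₀, X₁] w ≠ 1 := by
  have hfin : {w : FreeGroup (Fin 2) | w.norm ≤ n}.Finite :=
    (List.finite_length_le (Fin 2 × Bool) n).preimage FreeGroup.toWord_injective.injOn
  obtain ⟨m, hm, c, hc, hc5, hcm, hfree⟩ := exists_forall_lift_ne_one hfin.toFinset
  have hgen := F_le_closure hc hm hc5 hcm
  set g : Homeo := x 1 * (x 3)⁻¹ * c * x (m + 1) with hg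
  have hgF : g ∈ F :=
    F.mul_mem (F.mul_mem (F.mul_mem (mem_F _) (F.inv_mem (mem_F _))) (E_le_F hc)) (mem_F _)
  refine ⟨⟨x 0, mem_F 0⟩, ⟨g, hgF⟩, ?_, fun w hw hwn hw1 => ?_⟩
  · apply Subgroup.map_injective F.subtype_injective
    rw [MonoidHom.map_closure, Set.image_pair, ← MonoidHom.range_eq_map, Subgroup.range_subtype]
    refine le_antisymm ?_ hgen
    rw [Subgroup.closure_le]
    rintro _ (rfl | rfl)
    exacts [mem_F 0, hgF]
  · refine hfree g (fun t ht1 ht2 => ?_) w (by simpa using hwn) hw ?_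
    -- On `[5, m]` the outer factors do nothing: `x (m + 1)` is the identity up to `m + 1`, and `x 1
    -- * (x 3)⁻¹` is the identity from `5` on.
    · have h1 := apply_le_apply (E_le_increasing hc) ht1
      rw [hc5 5 le_rfl] at h1
      have h3 : x 1 * (x 3)⁻¹ ∈ fixGE 5 := by
        have := x_mul_inv_mem_fixGE (i := 1) (j := 3) (by omega)
        convert this using 2
        norm_num
      rw [hg, Homeomorph.mul_apply, x_apply_of_le (ht2.trans (by simp)), Homeomorph.mul_apply,
        h3 _ h1]
    · have h1 : FreeGroup.lift ![x 0, g] =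
          F.subtype.comp (FreeGroup.lift ![⟨x 0, mem_F 0⟩, ⟨g, hgF⟩]) := by
        ext1 i
        fin_cases i <;> simp
      rw [h1, MonoidHom.comp_apply, hw1, map_one]

end ThompsonF

/-! ### Convergence in the space of marked groups. -/

theorem MarkedGroup.relations_free (k : ℕ) : (MarkedGroup.free k).relations = ⊥ := by
  have h : (MarkedGroup.free k).eval = MonoidHom.id (FreeGroup (Fin k)) :=
    FreeGroup.lift_of_eq_id (Fin k)
  rw [MarkedGroup.relations, h]
  exact MonoidHom.ker_id

theorem MarkedGroupSpace.agree_free {k : ℕ} (A : MarkedGroup k) {n : ℕ}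
    (h : ∀ w : FreeGroup (Fin k), w ≠ 1 → w.norm ≤ n → A.eval w ≠ 1) :
    Agree (mk A) (mk (MarkedGroup.free k)) n := by
  intro w hw
  change w ∈ A.relations ↔ w ∈ (MarkedGroup.free k).relations
  rw [MarkedGroup.relations_free, Subgroup.mem_bot]
  refine ⟨fun hA => by_contra fun hw1 => h w hw1 hw hA, ?_⟩
  rintro rfl
  exact one_mem _

theorem theorem1 :
    MarkedGroupSpace.IsLimitOfMarkings ThompsonF.F (MarkedGroupSpace.mk (MarkedGroup.free 2)) ∧
    ∀ n : ℕ, ∃ X₀ X₁ : ThompsonF.F, Subgroup.closure {X₀, X₁} = ⊤ ∧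
      ∀ w : FreeGroup (Fin 2), w ≠ 1 → w.norm ≤ n → FreeGroup.lift ![X₀, X₁] w ≠ 1 := by
  refine ⟨?_, ThompsonF.exists_generating_pair⟩
  choose X₀ X₁ hgen hfree using ThompsonF.exists_generating_pair
  refine ⟨fun n => ⟨ThompsonF.F, ![X₀ n, X₁ n], by simpa [Set.pair_comm] using hgen n⟩,
    fun n => ⟨MulEquiv.refl _⟩, ?_⟩
  rw [tendsto_iff_dist_tendsto_zero]
  refine squeeze_zero (fun _ => dist_nonneg) (fun n => ?_)
    (Real.tendsto_exp_neg_atTop_nhds_zero.comp tendsto_natCast_atTop_atTop)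
  exact (MarkedGroupSpace.dist_le_exp_iff _ _ n).2 (MarkedGroupSpace.agree_free _ (hfree n))
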